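/- Let $F:\mathbb{R}^n\rightrightarrows\mathbb{R}^n$ be a Lipschitz multifunction with nonempty, convex and compact values (that is, for some $L\ge 0$, $F(x)\subset F(y)+L\|x-y\|\,\mathrm{B}(0,1)$ for all $x,y$), and let $A:\mathbb{R}^n\rightrightarrows\mathbb{R}^n$ be a maximal monotone operator with domain $\operatorname{dom}A=\{x: A(x)\neq\emptyset\}$. Here $\mathrm{B}(x,\rho)$ denotes the closed Euclidean ball. For $x_0\in\overline{\operatorname{dom}A}$, a solution starting at $x_0$ of the differential inclusion $$\dot x(t)\in F(x(t))-A(x(t))\quad\text{for a.e. } t\ge 0,\qquad x(0)=x_0, \tag{1}$$ is a continuous function $x:[0,\infty)\to\mathbb{R}^n$ that is absolutely continuous on every compact subset of $(0,\infty)$ and satisfies (1). For a closed set $S\subset\mathbb{R}^n$, let $\Pi_S(x)=\{s\in S:\ \|x-s\|=d_S(x)\}$ be the projection onto $S$, and for $x\in S$ let $\mathrm{N}^P_S(x)$ be the proximal normal cone, i.e. the set of all $\xi\in\mathbb{R}^n$ with $$\liminf_{y\to x,\ y\ne x}\ \frac{\mathrm{I}_S(y)-\mathrm{I}_S(x)-\langle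 \xi,y-x\rangle}{\|y-x\|^2}>-\infty,$$ where $\mathrm{I}_S$ is $0$ on $S$ and $+\infty$ off $S$. **Proposition.** Let $S\subset\overline{\operatorname{dom}A}$ be a closed set such that $\Pi_S(x)\subset S\cap\operatorname{dom}A$ for every $x\in\operatorname{dom}A$, and let $x_0\in S$. Suppose that there is some $\rho>0$ such that for every $x\in \mathrm{B}(x_0,\rho)\cap S\cap\operatorname{dom}A$, $$\sup_{\xi\in \mathrm{N}^P_S(x)}\ \sup_{v\in F(x)}\ \inf_{x^*\in A(x)}\ \langle \xi, v-x^*\rangle\le 0 .$$ Then for every solution $x(\cdot)$ of (1) starting at $x_0$ there exists $T>0$ such that $x(t)\in S$ for every $t\in[0,T]$. -/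

import Mathlib

open scoped Topology NNReal Pointwise

noncomputable section

namespace InclusionInvariance

/-- The Euclidean space `ℝⁿ`. -/
abbrev Euc (n : ℕ) : Type := EuclideanSpace ℝ (Fin n)

variable {n : ℕ}

/-- The domain of a multivalued operator. -/
def dom (A : Euc n → Set (Euc n)) : Set (Euc n) := {x | (A x).Nonempty}

/-- Monotonicity of a multivalued operator. -/
def IsMonotoneOp (A : Euc n → Set (Euc n)) : Prop :=
  ∀ x₁ x₂, ∀ y₁ ∈ A x₁, ∀ y₂ ∈ A x₂, 0 ≤ inner ℝ (y₁ - y₂) (x₁ - x₂)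

/-- Maximal monotonicity: the graph of `A` is not properly contained in the graph of
another monotone operator. -/
def IsMaximalMonotone (A : Euc n → Set (Euc n)) : Prop :=
  IsMonotoneOp A ∧
    ∀ B : Euc n → Set (Euc n), IsMonotoneOp B → (∀ x, A x ⊆ B x) → B = A

/-- Lipschitz multifunctions with nonempty, convex and compact values. The Lipschitz
condition is `F x ⊆ F y + closedBall 0 (L ‖x - y‖)`, written out pointwise. -/
structure IsLipschitzCusco (F : Euc n → Set (Euc n)) : Prop where
  nonempty : ∀ x, (F x).Nonempty
  convex : ∀ x, Convex ℝ (F x)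
  isCompact : ∀ x, IsCompact (F x)
  lipschitz : ∃ L : ℝ≥0, ∀ x y, ∀ v ∈ F x, ∃ w ∈ F y, ‖v - w‖ ≤ L * ‖x - y‖

/-- `x` (restricted to `[0, ∞)`) is a solution of `ẋ(t) ∈ F(x(t)) - A(x(t))` for a.e. `t ≥ 0`,
`x(0) = x₀ ∈ closure (dom A)`. It is continuous on `[0, ∞)` and absolutely continuous on
every compact interval of `(0, ∞)`. -/
structure IsSolution (F A : Euc n → Set (Euc n)) (x₀ : Euc n) (x : ℝ → Euc n) : Prop where
  init : x 0 = x₀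
  init_mem : x₀ ∈ closure (dom A)
  continuousOn : ContinuousOn x (Set.Ici 0)
  absolutelyContinuous : ∀ a b : ℝ, 0 < a → a ≤ b → AbsolutelyContinuousOnInterval x a b
  inclusion : ∀ᵐ t ∂(MeasureTheory.volume.restrict (Set.Ici (0 : ℝ))),
    DifferentiableAt ℝ x t ∧ deriv x t ∈ F (x t) - A (x t)

/-- The metric projection onto `S`. -/
def proj (S : Set (Euc n)) (x : Euc n) : Set (Euc n) :=
  {s | s ∈ S ∧ ‖x - s‖ = Metric.infDist x S}

open Classical in
/-- The indicator function of `S`: zero on `S` and `+∞` off `S`. -/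
def indicatorFn (S : Set (Euc n)) (x : Euc n) : EReal := if x ∈ S then 0 else ⊤

/-- The proximal subdifferential of an extended-real function; it is empty off the
effective domain. -/
def proximalSubdiff (φ : Euc n → EReal) (x : Euc n) : Set (Euc n) :=
  {ξ | φ x < ⊤ ∧
    ⊥ < Filter.liminf
      (fun y => (φ y - φ x - ((inner ℝ ξ (y - x) : ℝ) : EReal)) / ((‖y - x‖ ^ 2 : ℝ) : EReal))
      (𝓝[≠] x)}

/-- The proximal normal cone. -/
def proximalNormalCone (S : Set (Euc n)) (x : Euc n) : Set (Euc n) :=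
  proximalSubdiff (indicatorFn S) x

end InclusionInvariance

end

open MeasureTheory Set Filter

namespace InclusionInvariance

/-! Let `g t` be the squared distance from `x t` to `S`. If `s` is a projection of `x t`, then `x t
- s` is a proximal normal at `s`. The Lipschitz bound on `F`, the normal condition at `s` and
monotonicity of `A` then give `g' ≤ 2 * L * g` almost everywhere near time `0` (`inner_velocity_le`,
`deriv_infDist_sq_eq`). Grönwall's inequality and `g 0 = 0` force `g = 0`. -/

/-- Post-composition with a Lipschitz map preserves absolute continuity. -/
theorem absolutelyContinuousOnInterval_comp_lipschitz {X Y : Type*} [PseudoMetricSpace X]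
    [PseudoMetricSpace Y] {φ : X → Y} {K : ℝ≥0} (hφ : LipschitzWith K φ) {f : ℝ → X} {a b : ℝ}
    (hf : AbsolutelyContinuousOnInterval f a b) :
    AbsolutelyContinuousOnInterval (fun t ↦ φ (f t)) a b := by
  refine squeeze_zero (fun E ↦ ?_) (fun E ↦ ?_) (by simpa using Tendsto.const_mul (K : ℝ) hf)
  · exact Finset.sum_nonneg fun i _ ↦ dist_nonneg
  · rw [Finset.mul_sum]
    exact Finset.sum_le_sum fun i _ ↦ hφ.dist_le_mul _ _

/-- Grönwall's inequality for absolutely continuous functions. -/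
theorem exp_mul_le_of_ae_deriv_le {g : ℝ → ℝ} {a b c : ℝ}
    (hab : a ≤ b) (hg : AbsolutelyContinuousOnInterval g a b)
    (hderiv : ∀ᵐ t, t ∈ Icc a b → DifferentiableAt ℝ g t → deriv g t ≤ c * g t) :
    Real.exp (-c * b) * g b ≤ Real.exp (-c * a) * g a := by
  have he : AbsolutelyContinuousOnInterval (fun t ↦ Real.exp (-c * t)) a b :=
    ContDiffOn.absolutelyContinuousOnInterval (by fun_prop)
  have hint := (he.mul hg).integral_deriv_eq_sub
  have hdiff := hg.ae_differentiableAt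
  have hle : 0 ≤ ∫ t in a..b, -deriv ((fun t ↦ Real.exp (-c * t)) * g) t := by
    refine intervalIntegral.integral_nonneg_of_ae_restrict hab ?_
    rw [EventuallyLE, ae_restrict_iff' measurableSet_Icc]
    filter_upwards [hderiv, hdiff] with t h1 h2 ht
    have hd := h2 (by rwa [uIcc_of_le hab])
    have h1 := h1 ht hd
    have hexp : HasDerivAt (fun t ↦ Real.exp (-c * t)) (Real.exp (-c * t) * (-c)) t := by
      simpa using ((hasDerivAt_id t).const_mul (-c)).exp
    rw [(hexp.mul hd.hasDerivAt).deriv]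
    have := Real.exp_pos (-c * t)
    simp only [Pi.zero_apply]
    nlinarith
  rw [intervalIntegral.integral_neg, hint] at hle
  simp only [Pi.mul_apply] at hle
  linarith

variable {n : ℕ}

/-- The vector from a projection to the projected point is a proximal normal. -/
theorem sub_mem_proximalNormalCone {S : Set (Euc n)} {x s : Euc n} (hs : s ∈ proj S x) :
    x - s ∈ proximalNormalCone S s := by
  have hφ : indicatorFn S s = 0 := by simp [indicatorFn, hs.1]
  -- Squaring `‖x - s‖ ≤ ‖x - y‖` for `y ∈ S` gives `⟪x - s, y - s⟫ ≤ ‖y - s‖ ^ 2 / 2`, hence the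
  -- constant `-1 / 2`.
  refine ⟨by simp [hφ], lt_of_lt_of_le (EReal.bot_lt_coe (-1 / 2)) (le_liminf_of_le (h := ?_))⟩
  filter_upwards [self_mem_nhdsWithin] with y hy
  have hpos : (0 : ℝ) < ‖y - s‖ ^ 2 := by
    have : 0 < ‖y - s‖ := norm_pos_iff.2 (sub_ne_zero.2 hy)
    positivity
  rw [EReal.le_div_iff_mul_le (by exact_mod_cast hpos) (EReal.coe_ne_top _), hφ]
  by_cases hyS : y ∈ S
  · have h1 : ‖x - s‖ ≤ ‖x - y‖ := by
      rw [hs.2, ← dist_eq_norm]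
      exact Metric.infDist_le_dist_of_mem hyS
    have h2 := pow_le_pow_left₀ (norm_nonneg _) h1 2
    have h3 : x - y = (x - s) - (y - s) := by abel
    rw [h3, norm_sub_sq_real (x - s) (y - s)] at h2
    have : -1 / 2 * ‖y - s‖ ^ 2 ≤ 0 - 0 - inner ℝ (x - s) (y - s) := by linarith
    simp only [indicatorFn, hyS, if_true]
    rw [← EReal.coe_mul, ← EReal.coe_zero, ← EReal.coe_sub, ← EReal.coe_sub]
    exact EReal.coe_le_coe_iff.2 this
  · simp [indicatorFn, hyS]

theorem proj_nonempty {S : Set (Euc n)} (hS : IsClosed S) (hne : S.Nonempty) (x : Euc n) :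
    (proj S x).Nonempty := by
  obtain ⟨s, hs, h⟩ := hS.exists_infDist_eq_dist hne x
  exact ⟨s, hs, by rw [h, dist_eq_norm]⟩

/-- The infimum-supremum condition gives, for each normal and each `v ∈ F s`, elements of `A s`
realizing the inequality up to an arbitrarily small error. -/
theorem exists_inner_lt {F A : Euc n → Set (Euc n)} {S : Set (Euc n)} {s ξ v : Euc n}
    (h : (⨆ ξ ∈ proximalNormalCone S s, ⨆ v ∈ F s, ⨅ y ∈ A s,
      ((inner ℝ ξ (v - y) : ℝ) : EReal)) ≤ 0)
    (hξ : ξ ∈ proximalNormalCone S s) (hv : v ∈ F s) {ε : ℝ} (hε : 0 < ε) :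
    ∃ y ∈ A s, inner ℝ ξ (v - y) < ε := by
  simp only [iSup_le_iff] at h
  have h1 := (h ξ hξ v hv).trans_lt (show (0 : EReal) < (ε : EReal) by exact_mod_cast hε)
  simp only [iInf_lt_iff] at h1
  obtain ⟨y, hy, hlt⟩ := h1
  exact ⟨y, hy, by exact_mod_cast hlt⟩

/-- The one-sided estimate on velocities of the inclusion in the direction of the projection. -/
theorem inner_velocity_le {F A : Euc n → Set (Euc n)} {S : Set (Euc n)} {L : ℝ≥0}
    (hF : ∀ x y, ∀ v ∈ F x, ∃ w ∈ F y, ‖v - w‖ ≤ L * ‖x - y‖) (hA : IsMonotoneOp A)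
    {x s u : Euc n} (hs : s ∈ proj S x)
    (h : (⨆ ξ ∈ proximalNormalCone S s, ⨆ v ∈ F s, ⨅ y ∈ A s,
      ((inner ℝ ξ (v - y) : ℝ) : EReal)) ≤ 0)
    (hu : u ∈ F x - A x) :
    inner ℝ (x - s) u ≤ L * ‖x - s‖ ^ 2 := by
  obtain ⟨v, hv, z, hz, rfl⟩ := Set.mem_sub.1 hu
  obtain ⟨w, hw, hvw⟩ := hF x s v hv
  -- The infimum over `A s` need not be attained.
  refine le_of_forall_pos_le_add fun ε hε ↦ ?_
  obtain ⟨y, hy, hlt⟩ := exists_inner_lt h (sub_mem_proximalNormalCone hs) hw hε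
  have hm := hA x s z hz y hy
  rw [real_inner_comm] at hm
  have hcs := real_inner_le_norm (x - s) (v - w)
  have hb := mul_le_mul_of_nonneg_left hvw (norm_nonneg (x - s))
  -- The three terms are controlled by the Lipschitz bound, the normal condition and monotonicity,
  -- respectively.
  have hsplit : v - z = (v - w) + (w - y) - (z - y) := by abel
  rw [hsplit, inner_sub_right, inner_add_right]
  nlinarith

/-- The derivative of the squared distance to `S` along a curve is governed by the inner product
of the velocity with the vector from any projection. -/
theorem deriv_infDist_sq_eq {S : Set (Euc n)} {x : ℝ → Euc n} {s : Euc n} {t : ℝ}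
    (hs : s ∈ proj S (x t)) (hx : DifferentiableAt ℝ x t)
    (hg : DifferentiableAt ℝ (fun τ ↦ Metric.infDist (x τ) S ^ 2) t) :
    deriv (fun τ ↦ Metric.infDist (x τ) S ^ 2) t = 2 * inner ℝ (x t - s) (deriv x t) := by
  have hq : HasDerivAt (fun τ ↦ ‖x τ - s‖ ^ 2) (2 * inner ℝ (x t - s) (deriv x t)) t :=
    (hx.hasDerivAt.sub_const s).norm_sq
  -- Freezing `s` gives a smooth majorant of the squared distance that touches it at `t`, so the
  -- derivatives agree there.
  have hmax : IsLocalMax (fun τ ↦ Metric.infDist (x τ) S ^ 2 - ‖x τ - s‖ ^ 2) t := by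
    refine Eventually.of_forall fun τ ↦ ?_
    have h1 : Metric.infDist (x τ) S ≤ ‖x τ - s‖ := by
      rw [← dist_eq_norm]
      exact Metric.infDist_le_dist_of_mem hs.1
    have h2 := pow_le_pow_left₀ Metric.infDist_nonneg h1 2
    simp only [hs.2, sub_self]
    linarith
  have := hmax.hasDerivAt_eq_zero (hg.hasDerivAt.sub hq)
  linarith

end InclusionInvariance

open InclusionInvariance in
theorem mainTheorem7 (n : ℕ)
    (F A : InclusionInvariance.Euc n → Set (InclusionInvariance.Euc n))
    (hF : InclusionInvariance.IsLipschitzCusco F)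
    (hA : InclusionInvariance.IsMaximalMonotone A)
    (S : Set (InclusionInvariance.Euc n)) (hS : IsClosed S)
    (hSA : S ⊆ closure (InclusionInvariance.dom A))
    (hproj : ∀ x ∈ InclusionInvariance.dom A,
      InclusionInvariance.proj S x ⊆ S ∩ InclusionInvariance.dom A)
    (x₀ : InclusionInvariance.Euc n) (hx₀ : x₀ ∈ S)
    (hnormal : ∃ ρ : ℝ, 0 < ρ ∧
      ∀ x ∈ Metric.closedBall x₀ ρ ∩ S ∩ InclusionInvariance.dom A,
        (⨆ ξ ∈ InclusionInvariance.proximalNormalCone S x, ⨆ v ∈ F x, ⨅ y ∈ A x,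
          ((inner ℝ ξ (v - y) : ℝ) : EReal)) ≤ 0) :
    ∀ x : ℝ → InclusionInvariance.Euc n, InclusionInvariance.IsSolution F A x₀ x →
      ∃ T : ℝ, 0 < T ∧ ∀ t ∈ Set.Icc 0 T, x t ∈ S := by
  intro x hx
  obtain ⟨ρ, hρ, hn⟩ := hnormal
  obtain ⟨L, hL⟩ := hF.lipschitz
  have hne : S.Nonempty := ⟨x₀, hx₀⟩
  -- Radius `ρ / 2` suffices: `s` is no farther from `x t` than `x₀` is, so `dist s x₀ ≤ 2 * dist (x
  -- t) x₀ < ρ`.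
  obtain ⟨δ, hδ, hball⟩ := Metric.continuousWithinAt_iff.1
    (hx.continuousOn 0 self_mem_Ici) (ρ / 2) (half_pos hρ)
  have hnear : ∀ t ∈ Icc 0 (δ / 2), dist (x t) x₀ < ρ / 2 := by
    intro t ht
    rw [← hx.init]
    refine hball ht.1 ?_
    rw [Real.dist_eq, sub_zero, abs_of_nonneg ht.1]
    linarith [ht.2]
  set g : ℝ → ℝ := fun τ ↦ Metric.infDist (x τ) S ^ 2 with hgdef
  have hderiv : ∀ᵐ t, t ∈ Icc 0 (δ / 2) → DifferentiableAt ℝ g t →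
      deriv g t ≤ (2 * L) * g t := by
    filter_upwards [(ae_restrict_iff' measurableSet_Ici).1 hx.inclusion] with t hincl ht hg
    obtain ⟨hxd, hu⟩ := hincl ht.1
    obtain ⟨s, hs⟩ := proj_nonempty hS hne (x t)
    have hdom : x t ∈ dom A := by
      obtain ⟨v, -, z, hz, -⟩ := Set.mem_sub.1 hu
      exact ⟨z, hz⟩
    have hsA := hproj _ hdom hs
    have hsball : s ∈ Metric.closedBall x₀ ρ := by
      have h1 : dist (x t) s ≤ dist (x t) x₀ := by
        rw [dist_eq_norm, hs.2]
        exact Metric.infDist_le_dist_of_mem hx₀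
      have h2 := dist_triangle_left s x₀ (x t)
      have h3 := hnear t ht
      rw [Metric.mem_closedBall]
      linarith
    have hle := inner_velocity_le hL hA.1 hs (hn s ⟨⟨hsball, hs.1⟩, hsA.2⟩) hu
    rw [deriv_infDist_sq_eq hs hxd hg]
    rw [hs.2] at hle
    simp only [hgdef]
    linarith
  have hgcont : ContinuousOn g (Ici 0) :=
    ((Metric.continuous_infDist_pt S).comp_continuousOn hx.continuousOn).pow 2
  have hg0 : g 0 = 0 := by simp [hgdef, hx.init, Metric.infDist_zero_of_mem hx₀]
  refine ⟨δ / 2, half_pos hδ, fun b hb ↦ ?_⟩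
  rcases hb.1.eq_or_lt with rfl | hb0
  · rwa [hx.init]
  -- Absolute continuity may fail at `0`, so Grönwall starts at `a > 0`; continuity of `g` then
  -- allows `a → 0`.
  have hgron : ∀ a ∈ Ioo 0 b,
      Real.exp (-(2 * L) * b) * g b ≤ Real.exp (-(2 * L) * a) * g a := by
    intro a ha
    have hac := absolutelyContinuousOnInterval_comp_lipschitz
      (Metric.lipschitz_infDist_pt S) (hx.absolutelyContinuous a b ha.1 ha.2.le)
    have hgac : AbsolutelyContinuousOnInterval g a b := by
      have := hac.mul hac
      simpa only [hgdef, sq] using! this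
    refine exp_mul_le_of_ae_deriv_le ha.2.le hgac ?_
    filter_upwards [hderiv] with t ht hta
    exact ht ⟨ha.1.le.trans hta.1, hta.2.trans hb.2⟩
  have hlim : Tendsto (fun a ↦ Real.exp (-(2 * L) * a) * g a) (𝓝[>] 0) (𝓝 0) := by
    have hc : ContinuousWithinAt (fun a ↦ Real.exp (-(2 * L) * a) * g a) (Ici 0) 0 :=
      (by fun_prop : Continuous fun a : ℝ ↦ Real.exp (-(2 * L) * a)).continuousWithinAt.mul
        (hgcont 0 self_mem_Ici)
    have := (hc.mono Ioi_subset_Ici_self).tendsto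
    simpa [hg0] using this
  have hfin : Real.exp (-(2 * L) * b) * g b ≤ 0 := by
    refine ge_of_tendsto hlim ?_
    filter_upwards [Ioo_mem_nhdsGT hb0] with a ha using hgron a ha
  have hgb : g b ≤ 0 := nonpos_of_mul_nonpos_right hfin (Real.exp_pos _)
  have hd : Metric.infDist (x b) S = 0 := by
    have : Metric.infDist (x b) S ^ 2 = 0 := le_antisymm hgb (sq_nonneg _)
    exact pow_eq_zero_iff two_ne_zero |>.1 this
  exact (hS.mem_iff_infDist_zero hne).2 hd
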